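/- Let $X$ be a Euclidean space of finite dimension $n$ with norm $|\cdot|$, let $X^*$ be its dual with the dual Euclidean norm, and put $\langle x\rangle=(1+|x|^2)^{1/2}$ on $X$ and on $X^*$. Let $m\in\mathbb{R}$ and let $a$ be a symbol of degree $m$ on $X^*$, i.e. $a\in C^\infty(X^*;\mathbb{C})$ and for every $k\in\mathbb{N}$ there is $C_k>0$ such that $\|a^{(k)}(p)\|\le C_k\langle p\rangle^{m-k}$ for all $p\in X^*$. Let $\mathcal{F}^{-1}a\in\mathcal{S}'(X)$ be the inverse Fourier transform of the tempered distribution $a$, that is, $(\mathcal{F}^{-1}a)(\varphi)=\int_{X^*}a(p)\,\Big((2\pi)^{-n}\int_X e^{i p(x)}\varphi(x)\,dx\Big)\,dp$ for $\varphi\in\mathcal{S}(X)$. Then: (i) On $X\setminus\{0\}$ the distribution $\mathcal{F}^{-1}a$ is a $C^\infty$ function, again denoted by $\mathcal{F}^{-1}a$, and this function and all its derivatives decay at infinity more rapidly than any power of $\langle x\rangle^{-1}$. (ii) If $m+n>0$, then for every $N\in\mathbb{N}$ there is $C_N>0$ such that $|\mathcal{F}^{-1}a(x)|\le C_N\langle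 x\rangle^{-N}\left(1+|x|^{-m-n}\right)$ for all $x\in X\setminus\{0\}$. (iii) If $m<0$, then $\mathcal{F}^{-1}a\in L^1(X)$; that is, the distribution $\mathcal{F}^{-1}a$ on $X$ is given by an integrable function, which on $X\setminus\{0\}$ is the function in (i). -/

import Mathlib

open MeasureTheory FourierTransform
open scoped SchwartzMap ContDiff

namespace SymbolFourier

noncomputable section

/-- The Japanese bracket `⟨x⟩ = (1 + |x|²)^{1/2}`. -/
def japaneseBracket {V : Type*} [NormedAddCommGroup V] (x : V) : ℝ :=
  Real.sqrt (1 + ‖x‖ ^ 2)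

/-- `a ∈ 𝒮^m(V)`: `a : V → ℂ` is smooth and for every `k` there is `C_k > 0` with
`‖a^{(k)}(x)‖ ≤ C_k ⟨x⟩^{m-k}` for all `x`. -/
def IsSymbol {V : Type*} [NormedAddCommGroup V] [NormedSpace ℝ V] (m : ℝ) (a : V → ℂ) : Prop :=
  ContDiff ℝ ∞ a ∧ ∀ k : ℕ, ∃ C : ℝ, 0 < C ∧
    ∀ x : V, ‖iteratedFDeriv ℝ k a x‖ ≤ C * japaneseBracket x ^ (m - (k : ℝ))

theorem one_le_japaneseBracket {V : Type*} [NormedAddCommGroup V] (x : V) :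
    1 ≤ japaneseBracket x := by
  rw [japaneseBracket, Real.one_le_sqrt]
  nlinarith [sq_nonneg ‖x‖]

theorem japaneseBracket_le {V : Type*} [NormedAddCommGroup V] (x : V) :
    japaneseBracket x ≤ 1 + ‖x‖ := by
  rw [japaneseBracket, Real.sqrt_le_left (by positivity)]
  nlinarith [norm_nonneg x]

/-- Symbols have temperate growth, so they define tempered distributions. -/
theorem IsSymbol.hasTemperateGrowth {V : Type*} [NormedAddCommGroup V] [NormedSpace ℝ V]
    {m : ℝ} {a : V → ℂ} (ha : IsSymbol m a) : a.HasTemperateGrowth := by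
  refine ⟨ha.1, fun k => ?_⟩
  obtain ⟨C, hC, h⟩ := ha.2 k
  refine ⟨⌈|m|⌉₊, C, fun x => (h x).trans ?_⟩
  have h1 := one_le_japaneseBracket x
  have hle : m - (k : ℝ) ≤ (⌈|m|⌉₊ : ℝ) := by
    have := Nat.le_ceil |m|
    have := le_abs_self m
    have : (0 : ℝ) ≤ k := Nat.cast_nonneg k
    linarith
  calc C * japaneseBracket x ^ (m - (k : ℝ))
      ≤ C * japaneseBracket x ^ (⌈|m|⌉₊ : ℝ) := by
        gcongr
    _ = C * japaneseBracket x ^ ⌈|m|⌉₊ := by rw [Real.rpow_natCast]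
    _ ≤ C * (1 + ‖x‖) ^ ⌈|m|⌉₊ := by
        gcongr
        exact japaneseBracket_le x

section Dual

variable (X : Type*) [NormedAddCommGroup X] [InnerProductSpace ℝ X] [FiniteDimensional ℝ X]

/-- The linear isomorphism `X* ≃ X`, `p ↦ p^♯`, with `⟪p^♯, x⟫ = p x`. -/
def sharp : StrongDual ℝ X ≃L[ℝ] X :=
  LinearEquiv.toContinuousLinearEquiv
    { (InnerProductSpace.toDual ℝ X).symm.toEquiv with
      map_add' := fun p q => map_add (InnerProductSpace.toDual ℝ X).symm p q
      map_smul' := fun c p => by simp }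

theorem sharp_eq (p : StrongDual ℝ X) :
    sharp X p = (InnerProductSpace.toDual ℝ X).symm p := rfl

theorem inner_sharp (p : StrongDual ℝ X) (x : X) : inner ℝ (sharp X p) x = p x :=
  InnerProductSpace.toDual_symm_apply

/-- The linear isomorphism `p ↦ p^♯ / (2π)` from `X*` to `X`. -/
def scaledSharp : StrongDual ℝ X ≃L[ℝ] X :=
  (sharp X).trans (ContinuousLinearEquiv.smulLeft
    (Units.mk0 ((2 * Real.pi)⁻¹ : ℝ) (by positivity)))

theorem scaledSharp_apply (p : StrongDual ℝ X) :
    scaledSharp X p = (2 * Real.pi)⁻¹ • sharp X p := rfl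

variable [MeasurableSpace X] [BorelSpace X]

/-- Lebesgue measure on the Euclidean space `X*`: the image of the Lebesgue measure of `X`
under the Riesz isometry `X ≃ X*`. -/
def dualVolume : Measure (StrongDual ℝ X) :=
  Measure.map (sharp X).symm volume

instance : (dualVolume X).IsAddHaarMeasure :=
  inferInstanceAs (Measure.map (sharp X).symm volume).IsAddHaarMeasure

/-- The transformation `φ ↦ ((2π)^{-n} ∫_X e^{i p(x)} φ(x) dx)_{p ∈ X*}` from `𝓢(X)` to `𝓢(X*)`,
see `schwartzFourierInv_apply`. It is obtained from Mathlib's `𝓕⁻` (kernel `e^{2πi⟪x, y⟫}`)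
by substituting `y = p^♯ / (2π)`. -/
def schwartzFourierInv : 𝓢(X, ℂ) →L[ℂ] 𝓢(StrongDual ℝ X, ℂ) :=
  (((2 * Real.pi) ^ (-(Module.finrank ℝ X : ℤ)) : ℝ) : ℂ) •
    ((SchwartzMap.compCLMOfContinuousLinearEquiv ℂ (scaledSharp X)).comp
      (fourierInvCLM ℂ 𝓢(X, ℂ)))

theorem schwartzFourierInv_apply (φ : 𝓢(X, ℂ)) (p : StrongDual ℝ X) :
    schwartzFourierInv X φ p =
      (((2 * Real.pi) ^ (-(Module.finrank ℝ X : ℤ)) : ℝ) : ℂ) *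
        ∫ x : X, Complex.exp (Complex.I * (p x : ℂ)) * φ x := by
  have h : (𝓕⁻ φ) (scaledSharp X p) =
      ∫ x : X, Complex.exp (Complex.I * (p x : ℂ)) * φ x := by
    rw [SchwartzMap.fourierInv_coe, Real.fourierInv_eq']
    refine integral_congr_ae (Filter.Eventually.of_forall fun x => ?_)
    have hi : inner ℝ x (scaledSharp X p) = (2 * Real.pi)⁻¹ * p x := by
      rw [scaledSharp_apply, inner_smul_right, real_inner_comm, inner_sharp]
    have hpi : 2 * Real.pi * ((2 * Real.pi)⁻¹ * p x) = p x := by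
      field_simp
    simp only [hi, hpi, smul_eq_mul]
    rw [mul_comm Complex.I]
  rw [← h]
  rfl

/-- The inverse Fourier transformation `𝓕⁻¹ : 𝓢'(X*) → 𝓢'(X)`, the transpose of
`schwartzFourierInv`. On functions, it is `(2π)^{-n} ∫_{X*} e^{i p(x)} u(p) dp`. -/
def fourierInverse : 𝓢'(StrongDual ℝ X, ℂ) →L[ℂ] 𝓢'(X, ℂ) :=
  PointwiseConvergenceCLM.precomp ℂ (schwartzFourierInv X)

variable {X}

/-- `𝓕⁻¹ a` for a symbol `a` on `X*`. -/
def IsSymbol.fourierInverse {m : ℝ} {a : StrongDual ℝ X → ℂ} (ha : IsSymbol m a) : 𝓢'(X, ℂ) :=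
  SymbolFourier.fourierInverse X
    (ha.hasTemperateGrowth.toTemperedDistribution (dualVolume X))

theorem IsSymbol.fourierInverse_apply {m : ℝ} {a : StrongDual ℝ X → ℂ} (ha : IsSymbol m a)
    (φ : 𝓢(X, ℂ)) :
    ha.fourierInverse φ = ∫ p, schwartzFourierInv X φ p * a p ∂(dualVolume X) := rfl

/-- The distribution `u` coincides on the open set `U` with the function `f`:
`u φ = ∫ φ f` for all test functions `φ` with compact support in `U`. -/
def EqFunctionOn (u : 𝓢'(X, ℂ)) (f : X → ℂ) (U : Set X) : Prop :=
  ∀ φ : 𝓢(X, ℂ), HasCompactSupport φ → tsupport φ ⊆ U → u φ = ∫ x, φ x * f x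

/-- `u` is of class `𝒮` outside zero, and `f` is the function that it is there: on `X \ {0}`,
`u` equals `f`, which is smooth and decays at infinity, together with all its derivatives, more
rapidly than any power of `⟨x⟩⁻¹`. (The value of `f` at `0` is irrelevant here.) -/
def IsClassSOutsideZero (u : 𝓢'(X, ℂ)) (f : X → ℂ) : Prop :=
  EqFunctionOn u f {0}ᶜ ∧
  ContDiffOn ℝ ∞ f {0}ᶜ ∧
  ∀ k N : ℕ, (fun x => iteratedFDeriv ℝ k f x) =O[Filter.cocompact X]
    fun x => japaneseBracket x ^ (-(N : ℝ))

end Dual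

end

end SymbolFourier

/-! Littlewood–Paley decomposition. Let `n` be the dimension. A dyadic partition of unity cuts `a`
into pieces of frequency about `2^j`. Rescaled to unit size and divided by `2^{jm}`, they form a
bounded set of Schwartz functions: this is what the symbol estimates say. Since `𝓕⁻` is continuous
on `𝓢`, the transforms are `g_j(x) = 2^{j(m+n)} h_j(2^j x)` with `h_j` bounded in `𝓢`, so `|x|^k
|D^l g_j(x)| ≤ C 2^{j(m+n+l-k)}` for every `k`.

Taking `k > m+n+l`, the series `∑ g_j` converges off `0` with all its derivatives and decays
rapidly. Using `k = 0` for `2^j |x| ≤ 1` and large `k` otherwise gives `C |x|^{-t}` for every `t >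
0` with `t ≥ m+n`: `t = m+n` yields (ii), some `t < n` yields the integrable majorant for (iii).

The partial sums tend to `𝓕⁻ a` as distributions (`IsSymbol.tendsto_integral_sum_fourierPiece`);
dominated convergence in `x` identifies the limit with the sum of the series
(`IsSymbol.fourierInverse_eq_of_dominated`). -/

namespace SymbolFourier

/-! ### Series of functions with dyadic scaling bounds -/

section DyadicSeries

open Filter Topology

/-- A finite sum of powers of `q < 1` is bounded by the geometric series. -/
theorem sum_range_pow_le {q : ℝ} (h0 : 0 ≤ q) (h1 : q < 1) (J : ℕ) :
    ∑ j ∈ Finset.range J, q ^ j ≤ (1 - q)⁻¹ := by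
  rw [← tsum_geometric_of_lt_one h0 h1]
  exact (summable_geometric_of_lt_one h0 h1).sum_le_tsum _ fun _ _ => by positivity

/-- Split at the least `N` with `2^N r ≥ 1`: downwards from `N - 1` the first term decays with ratio
`2^{-s}`, upwards from `N` the second with ratio `1/2`. Neither bound depends on `r`. -/
theorem exists_sum_min_dyadic_le {s : ℝ} (hs : 0 < s) :
    ∃ C : ℝ, 0 < C ∧ ∀ r : ℝ, 0 < r → ∀ J : ℕ,
      ∑ j ∈ Finset.range J, min (((2 : ℝ) ^ j * r) ^ s) ((2 : ℝ) ^ j * r)⁻¹ ≤ C := by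
  set q : ℝ := (2 : ℝ) ^ (-s) with hq
  have hq0 : 0 < q := by positivity
  have hq1 : q < 1 := Real.rpow_lt_one_of_one_lt_of_neg (by norm_num) (by linarith)
  refine ⟨(1 - q)⁻¹ + (1 - 2⁻¹)⁻¹, by
    have : 0 < 1 - q := by linarith
    positivity, fun r hr J => ?_⟩
  have hex : ∃ N : ℕ, 1 ≤ (2 : ℝ) ^ N * r := by
    obtain ⟨N, hN⟩ := pow_unbounded_of_one_lt r⁻¹ (one_lt_two : (1 : ℝ) < 2)
    exact ⟨N, by rw [← inv_mul_cancel₀ hr.ne']; gcongr⟩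
  set N := Nat.find hex with hNdef
  have hN : 1 ≤ (2 : ℝ) ^ N * r := Nat.find_spec hex
  have hlow : ∀ j < N, min (((2 : ℝ) ^ j * r) ^ s) ((2 : ℝ) ^ j * r)⁻¹ ≤ q ^ (N - 1 - j) := by
    intro j hj
    have h1 : (2 : ℝ) ^ (N - 1) * r < 1 := not_le.1 (Nat.find_min hex (by omega))
    refine (min_le_left _ _).trans ?_
    have h2 : (2 : ℝ) ^ j * r ≤ ((2 : ℝ) ^ (N - 1 - j))⁻¹ := by
      rw [le_inv_comm₀ (by positivity) (by positivity), le_inv_comm₀ (by positivity) (by positivity)]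
      rw [← one_div, le_div_iff₀ (by positivity)]
      calc (2 : ℝ) ^ j * r * 2 ^ (N - 1 - j) = 2 ^ (j + (N - 1 - j)) * r := by rw [pow_add]; ring
        _ = 2 ^ (N - 1) * r := by congr 2; omega
        _ ≤ 1 := h1.le
    calc ((2 : ℝ) ^ j * r) ^ s ≤ (((2 : ℝ) ^ (N - 1 - j))⁻¹) ^ s := by gcongr
      _ = q ^ (N - 1 - j) := by
        rw [hq, ← Real.rpow_natCast, ← Real.rpow_natCast, ← Real.rpow_neg (by norm_num),
          ← Real.rpow_mul (by norm_num), ← Real.rpow_mul (by norm_num)]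
        ring_nf
  have hhigh : ∀ i : ℕ, min (((2 : ℝ) ^ (N + i) * r) ^ s) ((2 : ℝ) ^ (N + i) * r)⁻¹
      ≤ (2⁻¹ : ℝ) ^ i := by
    intro i
    refine (min_le_right _ _).trans ?_
    rw [inv_pow]
    gcongr
    rw [pow_add]
    nlinarith [pow_pos (two_pos : (0 : ℝ) < 2) i]
  -- The range is enlarged to `N + J` so that it can be cut at `N` even when `J < N`.
  calc ∑ j ∈ Finset.range J, min (((2 : ℝ) ^ j * r) ^ s) ((2 : ℝ) ^ j * r)⁻¹
      ≤ ∑ j ∈ Finset.range (N + J), min (((2 : ℝ) ^ j * r) ^ s) ((2 : ℝ) ^ j * r)⁻¹ := by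
        refine Finset.sum_le_sum_of_subset_of_nonneg
          (Finset.range_subset_range.2 (by omega)) fun _ _ _ => by positivity
    _ = ∑ j ∈ Finset.range N, min (((2 : ℝ) ^ j * r) ^ s) ((2 : ℝ) ^ j * r)⁻¹ +
        ∑ i ∈ Finset.range J, min (((2 : ℝ) ^ (N + i) * r) ^ s) ((2 : ℝ) ^ (N + i) * r)⁻¹ :=
        Finset.sum_range_add _ _ _
    _ ≤ ∑ j ∈ Finset.range N, q ^ (N - 1 - j) + ∑ i ∈ Finset.range J, (2⁻¹ : ℝ) ^ i :=
        add_le_add (Finset.sum_le_sum fun j hj => hlow j (Finset.mem_range.1 hj))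
          (Finset.sum_le_sum fun i _ => hhigh i)
    _ ≤ _ := by
        rw [Finset.sum_range_reflect (fun j => q ^ j)]
        exact add_le_add (sum_range_pow_le hq0.le hq1 N)
          (sum_range_pow_le (by norm_num) (by norm_num) J)

theorem two_pow_rpow (j : ℕ) (t : ℝ) : ((2 : ℝ) ^ j) ^ t = ((2 : ℝ) ^ t) ^ j := by
  rw [← Real.rpow_natCast, ← Real.rpow_natCast, ← Real.rpow_mul (by norm_num),
    ← Real.rpow_mul (by norm_num), mul_comm]

theorem summable_two_pow_rpow {t : ℝ} (ht : t < 0) :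
    Summable fun j : ℕ => ((2 : ℝ) ^ j) ^ t := by
  simp only [two_pow_rpow]
  exact summable_geometric_of_lt_one (by positivity)
    (Real.rpow_lt_one_of_one_lt_of_neg (by norm_num) ht)

variable {E F : Type*} [NormedAddCommGroup E] [NormedSpace ℝ E]
  [NormedAddCommGroup F] [NormedSpace ℝ F]

/-- A sequence of smooth functions which is bounded like `2^{js} h(2^j x)`, with `h` in a bounded
set of Schwartz functions. -/
structure IsDyadicFamily (s : ℝ) (g : ℕ → E → F) : Prop where
  contDiff : ∀ j, ContDiff ℝ ∞ (g j)
  bound : ∀ k n : ℕ, ∃ C : ℝ, 0 < C ∧ ∀ j x,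
    ‖x‖ ^ k * ‖iteratedFDeriv ℝ n (g j) x‖ ≤ C * ((2 : ℝ) ^ j) ^ (s + n - k)

variable {s : ℝ} {g : ℕ → E → F}

theorem IsDyadicFamily.norm_iteratedFDeriv_le (hg : IsDyadicFamily s g) (n k : ℕ) :
    ∃ C : ℝ, 0 < C ∧ ∀ j x, x ≠ 0 →
      ‖iteratedFDeriv ℝ n (g j) x‖ ≤ C * ((2 : ℝ) ^ j) ^ (s + n - k) * (‖x‖ ^ k)⁻¹ := by
  obtain ⟨C, hC, h⟩ := hg.bound k n
  refine ⟨C, hC, fun j x hx => ?_⟩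
  have : 0 < ‖x‖ := norm_pos_iff.2 hx
  rw [← div_eq_mul_inv, le_div_iff₀ (by positivity), mul_comm]
  exact h j x

/-- Off the origin `k` is free, and any `k > s + n` makes the bounds a convergent geometric series.
-/
theorem IsDyadicFamily.summable_iteratedFDeriv [CompleteSpace F] (hg : IsDyadicFamily s g) (n : ℕ)
    {x : E} (hx : x ≠ 0) : Summable fun j => iteratedFDeriv ℝ n (g j) x := by
  obtain ⟨k, hk⟩ := exists_nat_gt (s + n)
  obtain ⟨C, hC, h⟩ := hg.norm_iteratedFDeriv_le n k
  exact Summable.of_norm_bounded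
    (((summable_two_pow_rpow (t := s + n - k) (by linarith)).mul_left C).mul_right (‖x‖ ^ k)⁻¹)
    fun j => h j x hx

theorem IsDyadicFamily.hasSum [CompleteSpace F] (hg : IsDyadicFamily s g)
    {x : E} (hx : x ≠ 0) : HasSum (fun j => g j x) (∑' j, g j x) := by
  refine Summable.hasSum ?_
  have := hg.summable_iteratedFDeriv 0 hx
  simpa using ((continuousMultilinearCurryFin0 ℝ E F).toContinuousLinearEquiv.summable).2 this

/-- Termwise differentiation on the ball of radius `‖x‖ / 2` about `x`: it keeps away from `0`, so
the bounds on the derivatives of order `n + 1` are summable uniformly there. -/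
theorem IsDyadicFamily.hasFDerivAt_tsum [CompleteSpace F] (hg : IsDyadicFamily s g) (n : ℕ) {x : E}
    (hx : x ≠ 0) : HasFDerivAt (fun y => ∑' j, iteratedFDeriv ℝ n (g j) y)
      (∑' j, iteratedFDeriv ℝ (n + 1) (g j) x).curryLeft x := by
  have hx' : 0 < ‖x‖ := norm_pos_iff.2 hx
  obtain ⟨k, hk⟩ := exists_nat_gt (s + (n + 1 : ℕ))
  obtain ⟨C, hC, h⟩ := hg.norm_iteratedFDeriv_le (n + 1) k
  set U := Metric.ball x (‖x‖ / 2)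
  have hU : ∀ y ∈ U, ‖x‖ / 2 ≤ ‖y‖ := by
    intro y hy
    have h1 : ‖y - x‖ < ‖x‖ / 2 := by simpa [U, dist_eq_norm] using hy
    have h2 := norm_sub_norm_le x y
    rw [norm_sub_rev] at h2
    linarith
  have hU0 : ∀ y ∈ U, y ≠ 0 := fun y hy h0 => by
    have := hU y hy
    rw [h0, norm_zero] at this
    linarith
  have hxU : x ∈ U := Metric.mem_ball_self (by positivity)
  have key := hasFDerivAt_tsum_of_isPreconnected (𝕜 := ℝ) (x₀ := x) (x := x)
    (f := fun j y => iteratedFDeriv ℝ n (g j) y)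
    (f' := fun j y => (iteratedFDeriv ℝ (n + 1) (g j) y).curryLeft) (s := U)
    (((summable_two_pow_rpow (t := s + (n + 1 : ℕ) - k)
      (by linarith)).mul_left C).mul_right ((‖x‖ / 2) ^ k)⁻¹) Metric.isOpen_ball
    (convex_ball _ _).isPreconnected ?_ ?_ hxU (hg.summable_iteratedFDeriv n hx) hxU
  · have e : (∑' j, iteratedFDeriv ℝ (n + 1) (g j) x).curryLeft =
        ∑' j, (iteratedFDeriv ℝ (n + 1) (g j) x).curryLeft :=
      (continuousMultilinearCurryLeftEquiv ℝ
        (fun _ : Fin (n + 1) => E) F).toContinuousLinearEquiv.map_tsum (L := .unconditional ℕ)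
    rw [e]
    exact key
  · intro j y _
    have := (hg.contDiff j).differentiable_iteratedFDeriv (m := n) (by exact_mod_cast WithTop.coe_lt_top _) y
    exact this.hasFDerivAt.congr_fderiv (by ext; rfl)
  · intro j y hy
    have e : ‖(iteratedFDeriv ℝ (n + 1) (g j) y).curryLeft‖ = ‖iteratedFDeriv ℝ (n + 1) (g j) y‖ :=
      ContinuousMultilinearMap.curryLeft_norm _
    rw [e]
    refine (h j y (hU0 y hy)).trans ?_
    gcongr
    exact hU y hy

theorem IsDyadicFamily.hasFTaylorSeriesUpToOn [CompleteSpace F] (hg : IsDyadicFamily s g) :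
    HasFTaylorSeriesUpToOn ∞ (fun x => ∑' j, g j x)
      (fun x n => ∑' j, iteratedFDeriv ℝ n (g j) x) {0}ᶜ where
  zero_eq x hx := by
    have h := ((continuousMultilinearCurryFin0 ℝ E F).toContinuousLinearEquiv.map_tsum
      (f := fun j => iteratedFDeriv ℝ 0 (g j) x) (L := .unconditional ℕ))
    simpa using h
  fderivWithin n _ x hx := (hg.hasFDerivAt_tsum n hx).hasFDerivWithinAt
  cont n _ x hx := (hg.hasFDerivAt_tsum n hx).continuousAt.continuousWithinAt

theorem IsDyadicFamily.contDiffOn_tsum [CompleteSpace F] (hg : IsDyadicFamily s g) :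
    ContDiffOn ℝ ∞ (fun x => ∑' j, g j x) {0}ᶜ :=
  hg.hasFTaylorSeriesUpToOn.contDiffOn

theorem IsDyadicFamily.iteratedFDeriv_tsum [CompleteSpace F] (hg : IsDyadicFamily s g) (n : ℕ)
    {x : E} (hx : x ≠ 0) :
    iteratedFDeriv ℝ n (fun x => ∑' j, g j x) x = ∑' j, iteratedFDeriv ℝ n (g j) x := by
  have ho : IsOpen ({0}ᶜ : Set E) := isOpen_compl_singleton
  rw [← iteratedFDerivWithin_of_isOpen n ho hx]
  exact (hg.hasFTaylorSeriesUpToOn.eq_iteratedFDerivWithin_of_uniqueDiffOn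
    (by exact_mod_cast le_top) ho.uniqueDiffOn hx).symm

/-- Bounding partial sums of norms, uniformly in `J`, serves twice: for the sum of the series and as
a dominating function. -/
theorem IsDyadicFamily.exists_sum_norm_le_pow (hg : IsDyadicFamily s g) (n : ℕ) {k : ℕ}
    (hk : s + n < k) : ∃ C : ℝ, 0 < C ∧ ∀ x, x ≠ 0 → ∀ J : ℕ,
      ∑ j ∈ Finset.range J, ‖iteratedFDeriv ℝ n (g j) x‖ ≤ C * (‖x‖ ^ k)⁻¹ := by
  obtain ⟨C, hC, h⟩ := hg.norm_iteratedFDeriv_le n k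
  have hsum := summable_two_pow_rpow (t := s + n - k) (by linarith)
  have hpos : 0 < ∑' j : ℕ, ((2 : ℝ) ^ j) ^ (s + n - k) :=
    hsum.tsum_pos (fun _ => by positivity) 0 (by positivity)
  refine ⟨C * ∑' j : ℕ, ((2 : ℝ) ^ j) ^ (s + n - k), by positivity, fun x hx J => ?_⟩
  calc _ ≤ ∑ j ∈ Finset.range J, C * ((2 : ℝ) ^ j) ^ (s + n - k) * (‖x‖ ^ k)⁻¹ :=
        Finset.sum_le_sum fun j _ => h j x hx
    _ = C * (∑ j ∈ Finset.range J, ((2 : ℝ) ^ j) ^ (s + n - k)) * (‖x‖ ^ k)⁻¹ := by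
        rw [← Finset.sum_mul, ← Finset.mul_sum]
    _ ≤ _ := by
        gcongr
        exact hsum.sum_le_tsum _ fun _ _ => by positivity

/-- With `c = 2^j ≥ 1`, the exponent `s` may be raised to `t`. The bounds for weights `0` and `k`
then become `(c‖x‖)^t` and `(c‖x‖)^{t-k}` times `‖x‖^{-t}`, and `exists_sum_min_dyadic_le` sums
their minimum. -/
theorem IsDyadicFamily.exists_sum_norm_le_rpow (hg : IsDyadicFamily s g) {t : ℝ} (ht : 0 < t)
    (hst : s ≤ t) : ∃ C : ℝ, 0 < C ∧ ∀ x, x ≠ 0 → ∀ J : ℕ,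
      ∑ j ∈ Finset.range J, ‖g j x‖ ≤ C * ‖x‖ ^ (-t) := by
  -- This choice gives `t - k ≤ -1`.
  obtain ⟨k, hk⟩ := exists_nat_gt (t + 1)
  obtain ⟨C₀, hC₀, h₀⟩ := hg.norm_iteratedFDeriv_le 0 0
  obtain ⟨C₁, hC₁, h₁⟩ := hg.norm_iteratedFDeriv_le 0 k
  obtain ⟨C, hC, h⟩ := exists_sum_min_dyadic_le ht
  refine ⟨(C₀ + C₁) * C, by positivity, fun x hx J => ?_⟩
  have hr : 0 < ‖x‖ := norm_pos_iff.2 hx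
  have key : ∀ j, ‖g j x‖ ≤
      (C₀ + C₁) * min (((2 : ℝ) ^ j * ‖x‖) ^ t) ((2 : ℝ) ^ j * ‖x‖)⁻¹ * ‖x‖ ^ (-t) := by
    intro j
    have hc1 : (1 : ℝ) ≤ 2 ^ j := one_le_pow₀ (by norm_num)
    set c : ℝ := 2 ^ j
    have hc : 0 < c := by positivity
    have e : ∀ e : ℝ, (c * ‖x‖) ^ e = c ^ e * ‖x‖ ^ e := fun e =>
      Real.mul_rpow hc.le hr.le
    have hxx : ‖x‖ ^ t * ‖x‖ ^ (-t) = 1 := by rw [← Real.rpow_add hr]; simp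
    have h0 : ‖g j x‖ ≤ C₀ * (c * ‖x‖) ^ t * ‖x‖ ^ (-t) := by
      have := h₀ j x hx
      simp only [norm_iteratedFDeriv_zero, Nat.cast_zero, add_zero, sub_zero, pow_zero, inv_one,
        mul_one] at this
      rw [e, mul_assoc, mul_assoc, hxx, mul_one]
      refine this.trans ?_
      gcongr
    have h1 : ‖g j x‖ ≤ C₁ * (c * ‖x‖) ^ (t - k) * ‖x‖ ^ (-t) := by
      have := h₁ j x hx
      simp only [norm_iteratedFDeriv_zero, Nat.cast_zero, add_zero] at this
      refine this.trans ?_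
      rw [e, mul_assoc, mul_assoc, mul_assoc, ← Real.rpow_add hr, ← Real.rpow_natCast ‖x‖ k,
        ← Real.rpow_neg hr.le, show t - (k : ℝ) + -t = -k by ring]
      gcongr
    rcases le_or_gt (c * ‖x‖) 1 with hle | hgt
    · rw [min_eq_left]
      · refine h0.trans ?_
        gcongr
        linarith
      · calc (c * ‖x‖) ^ t ≤ 1 := Real.rpow_le_one (by positivity) hle ht.le
          _ ≤ _ := (one_le_inv₀ (by positivity)).2 hle
    · rw [min_eq_right]
      · refine h1.trans ?_
        gcongr
        · linarith
        · rw [← Real.rpow_neg_one]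
          exact Real.rpow_le_rpow_of_exponent_le hgt.le (by linarith)
      · calc _ ≤ (1 : ℝ) := inv_le_one_of_one_le₀ hgt.le
          _ ≤ _ := Real.one_le_rpow hgt.le ht.le
  calc _ ≤ ∑ j ∈ Finset.range J,
        (C₀ + C₁) * min (((2 : ℝ) ^ j * ‖x‖) ^ t) ((2 : ℝ) ^ j * ‖x‖)⁻¹ * ‖x‖ ^ (-t) :=
        Finset.sum_le_sum fun j _ => key j
    _ = (C₀ + C₁) * (∑ j ∈ Finset.range J,
        min (((2 : ℝ) ^ j * ‖x‖) ^ t) ((2 : ℝ) ^ j * ‖x‖)⁻¹) * ‖x‖ ^ (-t) := by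
        rw [← Finset.sum_mul, ← Finset.mul_sum]
    _ ≤ _ := by
        gcongr
        exact h _ hr J

theorem IsDyadicFamily.norm_tsum_le_of_sum_norm_le [CompleteSpace F] (hg : IsDyadicFamily s g)
    (n : ℕ) {x : E} (hx : x ≠ 0) {B : ℝ}
    (hB : ∀ J : ℕ, ∑ j ∈ Finset.range J, ‖iteratedFDeriv ℝ n (g j) x‖ ≤ B) :
    ‖iteratedFDeriv ℝ n (fun x => ∑' j, g j x) x‖ ≤ B := by
  rw [hg.iteratedFDeriv_tsum n hx]
  exact le_of_tendsto (hg.summable_iteratedFDeriv n hx).hasSum.tendsto_sum_nat.norm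
    (Eventually.of_forall fun J => (norm_sum_le _ _).trans (hB J))

end DyadicSeries

/-! ### Dyadic decomposition of a symbol -/

section Decomposition

variable {E V : Type*} [NormedAddCommGroup E] [NormedSpace ℝ E] [NormedAddCommGroup V]
  [NormedSpace ℝ V]

/-- A family of Schwartz functions that is bounded in every seminorm. -/
def IsSchwartzBounded {ι : Type*} (h : ι → 𝓢(E, ℂ)) : Prop :=
  ∀ k n : ℕ, ∃ C : ℝ, 0 < C ∧ ∀ i x, ‖x‖ ^ k * ‖iteratedFDeriv ℝ n (h i) x‖ ≤ C

/-- By continuity each seminorm of `T (h i)` is controlled by finitely many seminorms of `h i`. -/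
theorem IsSchwartzBounded.clm_apply {ι : Type*} {h : ι → 𝓢(E, ℂ)} (hh : IsSchwartzBounded h)
    (T : 𝓢(E, ℂ) →L[ℂ] 𝓢(E, ℂ)) : IsSchwartzBounded fun i => T (h i) := by
  intro k n
  have hcont : Continuous ((SchwartzMap.seminorm ℂ k n).comp T.toLinearMap) :=
    ((schwartz_withSeminorms ℂ E ℂ).continuous_seminorm (k, n)).comp T.continuous
  obtain ⟨S, C, -, hC⟩ := Seminorm.bound_of_continuous (schwartz_withSeminorms ℂ E ℂ) _ hcont
  choose B hB0 hB using hh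
  refine ⟨C * (∑ p ∈ S, B p.1 p.2) + 1, ?_, fun i x => ?_⟩
  · have : 0 ≤ ∑ p ∈ S, B p.1 p.2 := Finset.sum_nonneg fun p _ => (hB0 p.1 p.2).le
    positivity
  have h1 := hC (h i)
  have h2 : (S.sup (schwartzSeminormFamily ℂ E ℂ)) (h i) ≤ ∑ p ∈ S, B p.1 p.2 := by
    refine Seminorm.finset_sup_apply_le
      (Finset.sum_nonneg fun p _ => (hB0 p.1 p.2).le) fun p hp => ?_
    refine (SchwartzMap.seminorm_le_bound ℂ p.1 p.2 (h i) (hB0 _ _).le (hB p.1 p.2 i)).trans ?_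
    exact Finset.single_le_sum (f := fun p : ℕ × ℕ => B p.1 p.2)
      (fun p _ => (hB0 p.1 p.2).le) hp
  calc ‖x‖ ^ k * ‖iteratedFDeriv ℝ n (T (h i)) x‖ ≤ SchwartzMap.seminorm ℂ k n (T (h i)) :=
        SchwartzMap.le_seminorm ℂ k n _ x
    _ ≤ C * (S.sup (schwartzSeminormFamily ℂ E ℂ)) (h i) := h1
    _ ≤ C * (∑ p ∈ S, B p.1 p.2) := by gcongr
    _ ≤ _ := by linarith

/-- With `c = 2^j`, each derivative costs a factor `c`, and `‖x‖^k = c^{-k} ‖c x‖^k`. -/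
theorem IsSchwartzBounded.isDyadicFamily {h : ℕ → 𝓢(E, ℂ)} (hh : IsSchwartzBounded h) (s : ℝ) :
    IsDyadicFamily s fun j x => (((2 : ℝ) ^ j) ^ s) • h j ((2 : ℝ) ^ j • x) where
  contDiff j := by
    have := (h j).smooth ⊤
    exact (this.comp (contDiff_id.const_smul ((2 : ℝ) ^ j))).const_smul (((2 : ℝ) ^ j) ^ s)
  bound k n := by
    obtain ⟨C, hC, hb⟩ := hh k n
    refine ⟨C, hC, fun j x => ?_⟩
    set c : ℝ := 2 ^ j
    have hc : 0 < c := by positivity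
    have hs : ContDiff ℝ n fun x => h j (c • x) :=
      ((h j).smooth n).comp (contDiff_id.const_smul c)
    rw [iteratedFDeriv_const_smul_apply' hs.contDiffAt,
      iteratedFDeriv_comp_const_smul c ((h j).smooth n), norm_smul, norm_smul]
    have h1 := hb j (c • x)
    rw [norm_smul, mul_pow] at h1
    simp only [norm_pow, Real.norm_eq_abs, abs_of_pos hc] at h1 ⊢
    rw [abs_of_pos (by positivity), Real.rpow_sub hc, Real.rpow_add hc, Real.rpow_natCast,
      Real.rpow_natCast]
    calc ‖x‖ ^ k * (c ^ s * (c ^ n * ‖iteratedFDeriv ℝ n (h j) (c • x)‖))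
        = (c ^ k * ‖x‖ ^ k * ‖iteratedFDeriv ℝ n (h j) (c • x)‖) * (c ^ s * c ^ n / c ^ k) := by
          field_simp
      _ ≤ _ := by gcongr

theorem rpow_le_of_comparable {K c t : ℝ} (e : ℝ) (hK : 1 ≤ K) (hc : 0 < c) (h1 : c ≤ K * t)
    (h2 : t ≤ K * c) : t ^ e ≤ K ^ |e| * c ^ e := by
  have hK0 : 0 < K := by linarith
  have ht : 0 < t := by
    by_contra h
    nlinarith
  rcases le_total 0 e with he | he
  · rw [abs_of_nonneg he, ← Real.mul_rpow hK0.le hc.le]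
    gcongr
  · rw [abs_of_nonpos he]
    calc t ^ e ≤ (c / K) ^ e :=
          Real.rpow_le_rpow_of_nonpos (by positivity) (by rwa [div_le_iff₀' hK0]) he
      _ = K ^ (-e) * c ^ e := by
          rw [Real.div_rpow hc.le hK0.le, Real.rpow_neg hK0.le]; field_simp

theorem norm_le_japaneseBracket {V : Type*} [NormedAddCommGroup V] (x : V) : ‖x‖ ≤ japaneseBracket x :=
  Real.le_sqrt_of_sq_le (by linarith)

/-- Cutoff functions, equal to `χ` for `j = 0` and to `χ(y) - χ(2 y)` for `j > 0`. -/
def dyadicCutoff (χ : E → ℂ) : ℕ → E → ℂ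
  | 0, y => χ y
  | _ + 1, y => χ y - χ ((2 : ℝ) • y)

/-- Telescoping: the subtracted term at scale `2^{J+1}` is the full cutoff at scale `2^J`. -/
theorem sum_dyadicCutoff (χ : E → ℂ) (J : ℕ) (z : E) :
    ∑ j ∈ Finset.range (J + 1), dyadicCutoff χ j (((2 : ℝ) ^ j)⁻¹ • z) =
      χ (((2 : ℝ) ^ J)⁻¹ • z) := by
  induction J with
  | zero => simp [dyadicCutoff]
  | succ J ih =>
    rw [Finset.sum_range_succ, ih, dyadicCutoff, smul_smul,
      show (2 : ℝ) * ((2 : ℝ) ^ (J + 1))⁻¹ = ((2 : ℝ) ^ J)⁻¹ by rw [pow_succ]; field_simp]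
    ring

/-- A smooth function that is `1` on the unit ball and `0` outside the ball of radius `2`. -/
structure IsUnitCutoff (χ : E → ℂ) : Prop where
  contDiff : ContDiff ℝ ∞ χ
  one : ∀ y, ‖y‖ ≤ 1 → χ y = 1
  zero : ∀ y, 2 ≤ ‖y‖ → χ y = 0
  norm_le_one : ∀ y, ‖χ y‖ ≤ 1

theorem exists_isUnitCutoff [HasContDiffBump E] : ∃ χ : E → ℂ, IsUnitCutoff χ := by
  let f : ContDiffBump (0 : E) := ⟨1, 2, by norm_num, by norm_num⟩
  refine ⟨fun y => (f y : ℂ), Complex.ofRealCLM.contDiff.comp f.contDiff, fun y hy => ?_,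
    fun y hy => ?_, fun y => ?_⟩
  · simp [f.one_of_mem_closedBall (x := y) (by simpa [f] using hy)]
  · simp [f.zero_of_le_dist (x := y) (by simpa [f] using hy)]
  · simpa [abs_of_nonneg f.nonneg] using f.le_one

variable {χ : E → ℂ}

theorem IsUnitCutoff.contDiff_dyadicCutoff (hχ : IsUnitCutoff χ) (j : ℕ) :
    ContDiff ℝ ∞ (dyadicCutoff χ j) := by
  cases j with
  | zero => exact hχ.contDiff
  | succ j => exact hχ.contDiff.sub (hχ.contDiff.comp (contDiff_id.const_smul (2 : ℝ)))

/-- For `j > 0` both terms of the difference equal `1` inside the ball of radius `1/2` and cancel,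
leaving a shell on which a symbol has a definite size. -/
theorem IsUnitCutoff.tsupport_dyadicCutoff_subset (hχ : IsUnitCutoff χ) (j : ℕ) :
    tsupport (dyadicCutoff χ j) ⊆ {y | ‖y‖ ≤ 2 ∧ (j = 0 ∨ 2⁻¹ ≤ ‖y‖)} := by
  refine closure_minimal (fun y hy => ?_) ?_
  · cases j with
    | zero =>
      refine ⟨?_, .inl rfl⟩
      by_contra! h
      exact hy (hχ.zero y h.le)
    | succ j =>
      have e : ‖(2 : ℝ) • y‖ = 2 * ‖y‖ := by simp [norm_smul]
      refine ⟨?_, .inr ?_⟩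
      · by_contra! h
        refine hy ?_
        rw [dyadicCutoff, hχ.zero y h.le, hχ.zero _ (by rw [e]; linarith), sub_zero]
      · by_contra! h
        refine hy ?_
        rw [dyadicCutoff, hχ.one y (by linarith), hχ.one _ (by rw [e]; linarith), sub_self]
  · exact (isClosed_le continuous_norm continuous_const).inter
      (isClosed_const.union (isClosed_le continuous_const continuous_norm))

theorem IsUnitCutoff.hasCompactSupport_dyadicCutoff [ProperSpace E] (hχ : IsUnitCutoff χ) (j : ℕ) :
    HasCompactSupport (dyadicCutoff χ j) :=
  (isCompact_closedBall (0 : E) 2).of_isClosed_subset (isClosed_tsupport _) fun y hy => by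
    simpa using (hχ.tsupport_dyadicCutoff_subset j hy).1

/-- Uniform in `j` because only two functions occur: the cutoffs for `j = 0` and `j = 1`. -/
theorem IsUnitCutoff.exists_norm_iteratedFDeriv_dyadicCutoff_le [ProperSpace E]
    (hχ : IsUnitCutoff χ) (n : ℕ) :
    ∃ C : ℝ, 0 < C ∧ ∀ j y, ‖iteratedFDeriv ℝ n (dyadicCutoff χ j) y‖ ≤ C := by
  have key : ∀ j, ∃ C : ℝ, ∀ y, ‖iteratedFDeriv ℝ n (dyadicCutoff χ j) y‖ ≤ C := fun j =>
    ((hχ.contDiff_dyadicCutoff j).continuous_iteratedFDeriv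
      (by exact_mod_cast le_top)).bounded_above_of_compact_support
      ((hχ.hasCompactSupport_dyadicCutoff j).iteratedFDeriv n)
  obtain ⟨C₀, h₀⟩ := key 0
  obtain ⟨C₁, h₁⟩ := key 1
  refine ⟨max (max C₀ C₁) 1, by positivity, fun j y => ?_⟩
  cases j with
  | zero => exact (h₀ y).trans ((le_max_left _ _).trans (le_max_left _ _))
  | succ j => exact (h₁ y).trans ((le_max_right _ _).trans (le_max_left _ _))

variable {m : ℝ} {a : V → ℂ}

theorem IsSymbol.contDiff_rescale (ha : IsSymbol m a) (L : E ≃L[ℝ] V) (c d : ℝ) :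
    ContDiff ℝ ∞ fun y => d • a (L (c • y)) :=
  (ha.1.comp (L.contDiff.comp (contDiff_id.const_smul c))).const_smul d

/-- The dyadic pieces of the function `a ∘ L`, rescaled to unit size. -/
noncomputable def dyadicPiece (χ : E → ℂ) (m : ℝ) (a : V → ℂ) (L : E ≃L[ℝ] V) (j : ℕ) (y : E) : ℂ :=
  dyadicCutoff χ j y * ((((2 : ℝ) ^ j) ^ (-m)) • a (L ((2 : ℝ) ^ j • y)))

theorem IsSymbol.contDiff_dyadicPiece (ha : IsSymbol m a) (hχ : IsUnitCutoff χ) (L : E ≃L[ℝ] V)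
    (j : ℕ) : ContDiff ℝ ∞ (dyadicPiece χ m a L j) :=
  (hχ.contDiff_dyadicCutoff j).mul (ha.contDiff_rescale L _ _)

theorem IsUnitCutoff.hasCompactSupport_dyadicPiece [ProperSpace E] (hχ : IsUnitCutoff χ)
    (m : ℝ) (a : V → ℂ) (L : E ≃L[ℝ] V) (j : ℕ) : HasCompactSupport (dyadicPiece χ m a L j) :=
  (hχ.hasCompactSupport_dyadicCutoff j).mul_right

theorem japaneseBracket_comparable (L : E ≃L[ℝ] V) :
    ∃ K : ℝ, 1 ≤ K ∧ ∀ (j : ℕ) (y : E), ‖y‖ ≤ 2 → (j = 0 ∨ 2⁻¹ ≤ ‖y‖) →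
      (2 : ℝ) ^ j ≤ K * japaneseBracket (L ((2 : ℝ) ^ j • y)) ∧
      japaneseBracket (L ((2 : ℝ) ^ j • y)) ≤ K * (2 : ℝ) ^ j := by
  set A := ‖(L : E →L[ℝ] V)‖
  set B := ‖(L.symm : V →L[ℝ] E)‖
  have hA : 0 ≤ A := norm_nonneg _
  have hB : 0 ≤ B := norm_nonneg _
  -- `2 * A` comes from `‖y‖ ≤ 2` in the upper bound, `2 * B` from `‖y‖ ≥ 1/2` in the lower one. For
  -- `j = 0` the lower bound is just `⟨·⟩ ≥ 1`.
  refine ⟨1 + 2 * A + 2 * B, by linarith, fun j y hy hj => ?_⟩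
  have hc : (1 : ℝ) ≤ 2 ^ j := one_le_pow₀ (by norm_num)
  have hLy : ‖L y‖ ≤ A * ‖y‖ := (L : E →L[ℝ] V).le_opNorm y
  have hy' : ‖y‖ ≤ B * ‖L y‖ := by simpa using (L.symm : V →L[ℝ] E).le_opNorm (L y)
  have e : ‖L ((2 : ℝ) ^ j • y)‖ = 2 ^ j * ‖L y‖ := by rw [map_smul, norm_smul]; simp
  have h1 := one_le_japaneseBracket (L ((2 : ℝ) ^ j • y))
  constructor
  · rcases hj with rfl | hj
    · simp only [pow_zero] at h1 ⊢
      nlinarith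
    · have h2 := norm_le_japaneseBracket (L ((2 : ℝ) ^ j • y))
      rw [e] at h2
      have h3 : (2 : ℝ) ^ j ≤ 2 * B * (2 ^ j * ‖L y‖) := by nlinarith
      nlinarith
  · refine (japaneseBracket_le _).trans ?_
    rw [e]
    nlinarith [mul_nonneg hA (by positivity : (0 : ℝ) ≤ 2 ^ j),
      mul_nonneg hB (by positivity : (0 : ℝ) ≤ 2 ^ j),
      mul_le_mul_of_nonneg_left (hLy.trans (mul_le_mul_of_nonneg_left hy hA))
        (by positivity : (0 : ℝ) ≤ 2 ^ j)]

/-- On the shell `⟨L (2^j y)⟩` is comparable to `c = 2^j`, so the powers cancel: `c^{-m} c^n c^{m-n}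
= 1`. This is the only use of the decay of the derivatives of `a`. -/
theorem IsSymbol.exists_norm_iteratedFDeriv_rescale_le (ha : IsSymbol m a) (L : E ≃L[ℝ] V)
    (n : ℕ) : ∃ C : ℝ, 0 < C ∧ ∀ (j : ℕ) (y : E), ‖y‖ ≤ 2 → (j = 0 ∨ 2⁻¹ ≤ ‖y‖) →
      ‖iteratedFDeriv ℝ n (fun y => (((2 : ℝ) ^ j) ^ (-m)) • a (L ((2 : ℝ) ^ j • y))) y‖ ≤ C := by
  obtain ⟨K, hK, hcmp⟩ := japaneseBracket_comparable L
  obtain ⟨C, hC, hb⟩ := ha.2 n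
  have hK0 : 0 < K := by linarith
  refine ⟨C * K ^ |m - n| * ‖(L : E →L[ℝ] V)‖ ^ n + 1, by positivity, fun j y hy hj => ?_⟩
  obtain ⟨h1, h2⟩ := hcmp j y hy hj
  set c : ℝ := 2 ^ j
  have hc : 0 < c := by positivity
  have haL : ContDiff ℝ n fun y => a (L y) :=
    (ha.1.of_le (by exact_mod_cast le_top)).comp L.contDiff
  have hs : ContDiff ℝ n fun y => a (L (c • y)) :=
    haL.comp (contDiff_id.const_smul c)
  rw [iteratedFDeriv_const_smul_apply' hs.contDiffAt, iteratedFDeriv_comp_const_smul c haL,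
    norm_smul, norm_smul, norm_pow, Real.norm_of_nonneg hc.le,
    Real.norm_of_nonneg (by positivity)]
  have h3 : ‖iteratedFDeriv ℝ n (fun y => a (L y)) (c • y)‖ ≤
      C * japaneseBracket (L (c • y)) ^ (m - n) * ‖(L : E →L[ℝ] V)‖ ^ n := by
    have e := (L : E →L[ℝ] V).iteratedFDeriv_comp_right ha.1 (c • y) (i := n)
      (by exact_mod_cast le_top)
    change ‖iteratedFDeriv ℝ n (a ∘ (L : E →L[ℝ] V)) (c • y)‖ ≤ _
    rw [e]
    refine (ContinuousMultilinearMap.norm_compContinuousLinearMap_le _ _).trans ?_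
    rw [Finset.prod_const, Finset.card_univ, Fintype.card_fin]
    gcongr
    exact hb _
  calc c ^ (-m) * (c ^ n * ‖iteratedFDeriv ℝ n (fun y => a (L y)) (c • y)‖)
      ≤ c ^ (-m) * (c ^ n * (C * (K ^ |m - n| * c ^ (m - n)) * ‖(L : E →L[ℝ] V)‖ ^ n)) := by
        refine mul_le_mul_of_nonneg_left (mul_le_mul_of_nonneg_left (h3.trans ?_) (by positivity))
          (by positivity)
        gcongr
        exact rpow_le_of_comparable _ hK hc h1 h2
    _ = C * K ^ |m - n| * ‖(L : E →L[ℝ] V)‖ ^ n * (c ^ (-m) * c ^ n * c ^ (m - n)) := by ring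
    _ = C * K ^ |m - n| * ‖(L : E →L[ℝ] V)‖ ^ n := by
        rw [← Real.rpow_natCast c n, ← Real.rpow_add hc, ← Real.rpow_add hc]
        simp
    _ ≤ _ := by linarith

/-- The dyadic pieces as Schwartz functions. -/
noncomputable def dyadicSchwartz [ProperSpace E] (ha : IsSymbol m a) (hχ : IsUnitCutoff χ)
    (L : E ≃L[ℝ] V) (j : ℕ) : 𝓢(E, ℂ) :=
  (hχ.hasCompactSupport_dyadicPiece m a L j).toSchwartzMap (ha.contDiff_dyadicPiece hχ L j)

theorem dyadicSchwartz_apply [ProperSpace E] (ha : IsSymbol m a) (hχ : IsUnitCutoff χ)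
    (L : E ≃L[ℝ] V) (j : ℕ) (y : E) :
    dyadicSchwartz ha hχ L j y = dyadicPiece χ m a L j y := rfl

/-- Leibniz' rule on the support of the cutoff, where `‖y‖ ≤ 2` turns the weight into `2 ^ k`;
elsewhere the derivatives vanish. -/
theorem isSchwartzBounded_dyadicSchwartz [ProperSpace E] (ha : IsSymbol m a)
    (hχ : IsUnitCutoff χ) (L : E ≃L[ℝ] V) : IsSchwartzBounded (dyadicSchwartz ha hχ L) := by
  intro k n
  choose B hB0 hB using hχ.exists_norm_iteratedFDeriv_dyadicCutoff_le
  choose D hD0 hD using ha.exists_norm_iteratedFDeriv_rescale_le L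
  refine ⟨2 ^ k * ∑ i ∈ Finset.range (n + 1), (n.choose i : ℝ) * B i * D (n - i), ?_,
    fun j y => ?_⟩
  · refine mul_pos (by positivity) (Finset.sum_pos (fun i hi => ?_) (by simp))
    have : 0 < n.choose i := Nat.choose_pos (by simpa [Nat.lt_succ_iff] using hi)
    have := hB0 i
    have := hD0 (n - i)
    positivity
  have hnn : 0 ≤ ∑ i ∈ Finset.range (n + 1), (n.choose i : ℝ) * B i * D (n - i) :=
    Finset.sum_nonneg fun i _ => by
      have := hB0 i
      have := hD0 (n - i)
      positivity
  change ‖y‖ ^ k * ‖iteratedFDeriv ℝ n (dyadicPiece χ m a L j) y‖ ≤ _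
  by_cases hy : y ∈ tsupport (dyadicCutoff χ j)
  · obtain ⟨h1, h2⟩ := hχ.tsupport_dyadicCutoff_subset j hy
    refine mul_le_mul (by gcongr) ?_ (norm_nonneg _) (by positivity)
    refine (norm_iteratedFDeriv_mul_le (N := ∞) (hχ.contDiff_dyadicCutoff j)
      (ha.contDiff_rescale L _ _) y
      (by exact_mod_cast le_top)).trans ?_
    refine Finset.sum_le_sum fun i _ => ?_
    have := hB i j y
    have := hD (n - i) j y h1 h2
    have := (hB0 i).le
    gcongr
  · have : iteratedFDeriv ℝ n (dyadicPiece χ m a L j) y = 0 := by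
      refine image_eq_zero_of_notMem_tsupport fun h => hy ?_
      exact closure_mono (Function.support_mul_subset_left _ _)
        (tsupport_iteratedFDeriv_subset n h)
    rw [this, norm_zero, mul_zero]
    positivity

end Decomposition

/-! ### Pairing the dyadic series with test functions -/

section Pairing

open Filter Topology

variable {X : Type*} [NormedAddCommGroup X] [InnerProductSpace ℝ X] [FiniteDimensional ℝ X]
  [MeasurableSpace X] [BorelSpace X]

/-- Substituting `z = p^♯ / (2π)`, the Jacobian cancels the normalisation `(2π)^{-n}`, so all
further work uses Mathlib's `𝓕⁻` on `X`. -/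
theorem IsSymbol.fourierInverse_apply_eq_integral {m : ℝ} {a : StrongDual ℝ X → ℂ}
    (ha : IsSymbol m a) (φ : 𝓢(X, ℂ)) :
    ha.fourierInverse φ = ∫ z : X, 𝓕⁻ φ z * a ((scaledSharp X).symm z) := by
  have hsymm : ∀ x : X, (scaledSharp X).symm ((2 * Real.pi)⁻¹ • x) = (sharp X).symm x := by
    intro x
    rw [ContinuousLinearEquiv.symm_apply_eq, scaledSharp_apply,
      ContinuousLinearEquiv.apply_symm_apply]
  have hemb : MeasurableEmbedding (sharp X).symm :=
    (sharp X).symm.toHomeomorph.measurableEmbedding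
  rw [ha.fourierInverse_apply, dualVolume, hemb.integral_map]
  have h1 : ∀ x : X, schwartzFourierInv X φ ((sharp X).symm x) * a ((sharp X).symm x) =
      (((2 * Real.pi) ^ (-(Module.finrank ℝ X : ℤ)) : ℝ) : ℂ) *
        (fun z : X => 𝓕⁻ φ z * a ((scaledSharp X).symm z)) ((2 * Real.pi)⁻¹ • x) := by
    intro x
    have h3 : schwartzFourierInv X φ ((sharp X).symm x) =
        (((2 * Real.pi) ^ (-(Module.finrank ℝ X : ℤ)) : ℝ) : ℂ) *
          𝓕⁻ φ (scaledSharp X ((sharp X).symm x)) := rfl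
    simp only [hsymm]
    rw [h3, scaledSharp_apply, ContinuousLinearEquiv.apply_symm_apply, mul_assoc]
  rw [integral_congr_ae (Eventually.of_forall h1), integral_const_mul,
    Measure.integral_comp_inv_smul volume
      (fun z : X => 𝓕⁻ φ z * a ((scaledSharp X).symm z)), abs_of_pos (by positivity),
    Complex.real_smul, ← mul_assoc, ← Complex.ofReal_mul, zpow_neg, zpow_natCast,
    inv_mul_cancel₀ (by positivity), Complex.ofReal_one, one_mul]

/-- Fourier duality for a dilated Schwartz function. -/
theorem integral_fourierInv_mul_dilation (φ b : 𝓢(X, ℂ)) {c : ℝ} (hc : 0 < c) :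
    ∫ z, 𝓕⁻ φ z * b (c⁻¹ • z) =
      ∫ x, φ x * (c ^ Module.finrank ℝ X • 𝓕⁻ b (c • x)) := by
  let S : X ≃L[ℝ] X := ContinuousLinearEquiv.smulLeft (Units.mk0 c⁻¹ (by positivity))
  let b' : 𝓢(X, ℂ) := SchwartzMap.compCLMOfContinuousLinearEquiv ℂ S b
  have hb' : ∀ z, b' z = b (c⁻¹ • z) := fun z => rfl
  have hF : ∀ x, 𝓕⁻ b' x = c ^ Module.finrank ℝ X • 𝓕⁻ b (c • x) := by
    intro x
    rw [SchwartzMap.fourierInv_coe, SchwartzMap.fourierInv_coe, Real.fourierInv_eq',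
      Real.fourierInv_eq']
    have := Measure.integral_comp_inv_smul (volume : Measure X)
      (fun w : X => Complex.exp (↑(2 * Real.pi * inner ℝ w (c • x)) * Complex.I) • b w) c
    rw [abs_of_pos (by positivity)] at this
    rw [← this]
    refine integral_congr_ae (Eventually.of_forall fun v => ?_)
    simp only [hb', inner_smul_left, inner_smul_right]
    congr 5
    simp [hc.ne']
  have := SchwartzMap.integral_fourierInv_mul_eq φ b'
  simpa only [hb', hF] using this

variable {m : ℝ} {a : StrongDual ℝ X → ℂ} {χ : X → ℂ}

/-- The dyadic pieces of `𝓕⁻ a`. -/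
noncomputable def fourierPiece (ha : IsSymbol m a) (hχ : IsUnitCutoff χ) (j : ℕ) (x : X) : ℂ :=
  (((2 : ℝ) ^ j) ^ (m + Module.finrank ℝ X)) •
    𝓕⁻ (dyadicSchwartz ha hχ (scaledSharp X).symm j) ((2 : ℝ) ^ j • x)

/-- In the order, `m` is the size of the symbol and the dimension comes from dilating the Fourier
integral. -/
theorem isDyadicFamily_fourierPiece (ha : IsSymbol m a) (hχ : IsUnitCutoff χ) :
    IsDyadicFamily (m + Module.finrank ℝ X) (fourierPiece ha hχ) :=
  ((isSchwartzBounded_dyadicSchwartz ha hχ _).clm_apply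
    (fourierInvCLM ℂ 𝓢(X, ℂ))).isDyadicFamily _

theorem continuous_fourierPiece (ha : IsSymbol m a) (hχ : IsUnitCutoff χ) (j : ℕ) :
    Continuous (fourierPiece ha hχ j) :=
  ((isDyadicFamily_fourierPiece ha hχ).contDiff j).continuous

theorem norm_fourierPiece_le (ha : IsSymbol m a) (hχ : IsUnitCutoff χ) :
    ∃ C : ℝ, 0 < C ∧ ∀ j x,
      ‖fourierPiece ha hχ j x‖ ≤ C * ((2 : ℝ) ^ j) ^ (m + Module.finrank ℝ X) := by
  simpa using (isDyadicFamily_fourierPiece ha hχ).bound 0 0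

theorem integrable_mul_fourierPiece (ha : IsSymbol m a) (hχ : IsUnitCutoff χ) (φ : 𝓢(X, ℂ))
    (j : ℕ) : Integrable fun x => φ x * fourierPiece ha hχ j x := by
  obtain ⟨C, -, hC⟩ := norm_fourierPiece_le ha hχ
  exact φ.integrable.mul_bdd (continuous_fourierPiece ha hχ j).aestronglyMeasurable
    (Eventually.of_forall fun x => hC j x)

theorem integral_mul_fourierPiece (ha : IsSymbol m a) (hχ : IsUnitCutoff χ) (φ : 𝓢(X, ℂ))
    (j : ℕ) : ∫ x, φ x * fourierPiece ha hχ j x =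
      ∫ z, 𝓕⁻ φ z *
        (dyadicCutoff χ j (((2 : ℝ) ^ j)⁻¹ • z) * a ((scaledSharp X).symm z)) := by
  have hc : (0 : ℝ) < 2 ^ j := by positivity
  have h := integral_fourierInv_mul_dilation φ
    (dyadicSchwartz ha hχ (scaledSharp X).symm j) hc
  set c : ℝ := 2 ^ j with hcj
  have hl : ∀ x, φ x * fourierPiece ha hχ j x = ((c ^ m : ℝ) : ℂ) * (φ x *
      (c ^ Module.finrank ℝ X • 𝓕⁻ (dyadicSchwartz ha hχ (scaledSharp X).symm j) (c • x))) := by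
    intro x
    rw [fourierPiece, ← hcj, Real.rpow_add hc, Real.rpow_natCast, mul_smul,
      Complex.real_smul (x := c ^ m)]
    ring
  have hr : ∀ z, 𝓕⁻ φ z * (dyadicCutoff χ j (c⁻¹ • z) * a ((scaledSharp X).symm z)) =
      ((c ^ m : ℝ) : ℂ) * (𝓕⁻ φ z * dyadicSchwartz ha hχ (scaledSharp X).symm j (c⁻¹ • z)) := by
    intro z
    have h1 : ((c ^ m : ℝ) : ℂ) * ((c ^ (-m) : ℝ) : ℂ) = 1 := by
      rw [← Complex.ofReal_mul, ← Real.rpow_add hc, add_neg_cancel, Real.rpow_zero,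
        Complex.ofReal_one]
    rw [dyadicSchwartz_apply, dyadicPiece, ← hcj, smul_inv_smul₀ hc.ne', Complex.real_smul]
    linear_combination (-(𝓕⁻ φ z * dyadicCutoff χ j (c⁻¹ • z) * a ((scaledSharp X).symm z))) * h1
  simp only [hl, hr, integral_const_mul, h]

theorem IsSymbol.integrable_mul (ha : IsSymbol m a) (ψ : 𝓢(X, ℂ)) :
    Integrable fun z => ψ z * a ((scaledSharp X).symm z) := by
  have hg : (fun z => a ((scaledSharp X).symm z)).HasTemperateGrowth :=
    ha.hasTemperateGrowth.comp ((scaledSharp X).symm : X →L[ℝ] StrongDual ℝ X).hasTemperateGrowth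
  have := (SchwartzMap.smulLeftCLM ℂ (fun z => a ((scaledSharp X).symm z)) ψ).integrable
    (μ := (volume : Measure X))
  refine this.congr (Eventually.of_forall fun z => ?_)
  rw [SchwartzMap.smulLeftCLM_apply_apply hg, smul_eq_mul, mul_comm]

/-- On the frequency side the partial sum telescopes to `χ(2^{-J} z)`, which is bounded by `1` and
tends to `1`; dominated convergence applies for every `m`. -/
theorem IsSymbol.tendsto_integral_sum_fourierPiece (ha : IsSymbol m a) (hχ : IsUnitCutoff χ)
    (φ : 𝓢(X, ℂ)) :
    Tendsto (fun J => ∫ x, φ x * ∑ j ∈ Finset.range J, fourierPiece ha hχ j x) atTop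
      (𝓝 (ha.fourierInverse φ)) := by
  rw [← tendsto_add_atTop_iff_nat 1, ha.fourierInverse_apply_eq_integral]
  have hcut : ∀ j, Continuous fun z => dyadicCutoff χ j (((2 : ℝ) ^ j)⁻¹ • z) := fun j =>
    (hχ.contDiff_dyadicCutoff j).continuous.comp (continuous_const_smul _)
  have hψ := ha.integrable_mul (𝓕⁻ φ)
  have hint : ∀ j, Integrable fun z => 𝓕⁻ φ z *
      (dyadicCutoff χ j (((2 : ℝ) ^ j)⁻¹ • z) * a ((scaledSharp X).symm z)) := by
    intro j
    obtain ⟨C, -, hC⟩ := hχ.exists_norm_iteratedFDeriv_dyadicCutoff_le 0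
    simp only [norm_iteratedFDeriv_zero] at hC
    refine (hψ.bdd_mul (hcut j).aestronglyMeasurable
      (Eventually.of_forall fun z => hC j _)).congr (Eventually.of_forall fun z => ?_)
    simp only
    ring
  have hJ : ∀ J : ℕ, ∫ x, φ x * ∑ j ∈ Finset.range (J + 1), fourierPiece ha hχ j x =
      ∫ z, χ (((2 : ℝ) ^ J)⁻¹ • z) * (𝓕⁻ φ z * a ((scaledSharp X).symm z)) := by
    intro J
    simp only [Finset.mul_sum]
    rw [integral_finsetSum _ fun j _ => integrable_mul_fourierPiece ha hχ φ j]
    simp only [integral_mul_fourierPiece]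
    rw [← integral_finsetSum _ fun j _ => hint j]
    refine integral_congr_ae (Eventually.of_forall fun z => ?_)
    simp only
    rw [← Finset.mul_sum, ← Finset.sum_mul, sum_dyadicCutoff]
    ring
  simp only [hJ]
  refine tendsto_integral_of_dominated_convergence
    (fun z => ‖𝓕⁻ φ z * a ((scaledSharp X).symm z)‖) (fun J => ?_) hψ.norm (fun J => ?_) ?_
  · exact (hχ.contDiff.continuous.comp (continuous_const_smul _)).aestronglyMeasurable.mul
      hψ.aestronglyMeasurable
  · refine Eventually.of_forall fun z => ?_
    rw [norm_mul]
    exact mul_le_of_le_one_left (norm_nonneg _) (hχ.norm_le_one _)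
  · refine Eventually.of_forall fun z => ?_
    -- At fixed `z` the integrand is eventually constant: `χ(2^{-J} z) = 1` once `2^J ≥ ‖z‖`.
    obtain ⟨J₀, hJ₀⟩ := pow_unbounded_of_one_lt ‖z‖ (one_lt_two : (1 : ℝ) < 2)
    refine tendsto_const_nhds.congr' ?_
    filter_upwards [eventually_ge_atTop J₀] with J hJ
    have h1 : ‖z‖ ≤ 2 ^ J := hJ₀.le.trans (pow_le_pow_right₀ (by norm_num) hJ)
    rw [hχ.one, one_mul]
    rw [norm_smul, norm_inv, norm_pow, Real.norm_two, inv_mul_le_iff₀ (by positivity), mul_one]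
    exact h1

/-- `𝓕⁻ a` is given by a function against those test functions for which the dyadic series can be
integrated by dominated convergence. -/
theorem IsSymbol.fourierInverse_eq_of_dominated (ha : IsSymbol m a) (hχ : IsUnitCutoff χ)
    (φ : 𝓢(X, ℂ)) {f : X → ℂ} {H : X → ℝ} (hH : Integrable H)
    (hbound : ∀ J : ℕ, ∀ᵐ x : X, ‖φ x‖ * ∑ j ∈ Finset.range J, ‖fourierPiece ha hχ j x‖ ≤ H x)
    (hf : ∀ᵐ x : X, φ x ≠ 0 → HasSum (fun j => fourierPiece ha hχ j x) (f x)) :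
    ha.fourierInverse φ = ∫ x, φ x * f x := by
  refine tendsto_nhds_unique (ha.tendsto_integral_sum_fourierPiece hχ φ)
    (tendsto_integral_of_dominated_convergence H (fun J => ?_) hH (fun J => ?_) ?_)
  · exact (φ.continuous.mul (continuous_finsetSum _ fun j _ =>
      continuous_fourierPiece ha hχ j)).aestronglyMeasurable
  · filter_upwards [hbound J] with x hx
    rw [norm_mul]
    exact (mul_le_mul_of_nonneg_left (norm_sum_le _ _) (norm_nonneg _)).trans hx
  · filter_upwards [hf] with x hx
    by_cases h0 : φ x = 0
    · simp [h0]
    · exact (hx h0).tendsto_sum_nat.const_mul _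

end Pairing

/-! ### Decay, integrability and identification of the sum -/

section Main

open Filter Topology

theorem inv_norm_pow_le_japaneseBracket {V : Type*} [NormedAddCommGroup V] {x : V}
    (hx : 1 ≤ ‖x‖) {N k : ℕ} (hN : N ≤ k) :
    (‖x‖ ^ k)⁻¹ ≤ 2 ^ N * japaneseBracket x ^ (-(N : ℝ)) := by
  have hJ : 0 < japaneseBracket x := one_pos.trans_le (one_le_japaneseBracket x)
  rw [Real.rpow_neg hJ.le, Real.rpow_natCast, ← div_eq_mul_inv, ← div_pow]
  calc (‖x‖ ^ k)⁻¹ ≤ (‖x‖ ^ N)⁻¹ := by gcongr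
    _ = (‖x‖⁻¹) ^ N := (inv_pow _ _).symm
    _ ≤ (2 / japaneseBracket x) ^ N := by
        gcongr
        rw [inv_le_comm₀ (by positivity) (by positivity), inv_div, div_le_iff₀ two_pos]
        linarith [japaneseBracket_le x]

theorem one_le_two_pow_mul_japaneseBracket {V : Type*} [NormedAddCommGroup V] {x : V}
    (hx : ‖x‖ ≤ 1) (N : ℕ) : 1 ≤ 2 ^ N * japaneseBracket x ^ (-(N : ℝ)) := by
  have hJ : 0 < japaneseBracket x := one_pos.trans_le (one_le_japaneseBracket x)
  rw [Real.rpow_neg hJ.le, Real.rpow_natCast, ← div_eq_mul_inv, ← div_pow]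
  refine one_le_pow₀ ?_
  rw [one_le_div hJ]
  linarith [japaneseBracket_le x]

variable {X : Type*} [NormedAddCommGroup X] [InnerProductSpace ℝ X] [FiniteDimensional ℝ X]

theorem IsDyadicFamily.isBigO_iteratedFDeriv_tsum {s : ℝ} {g : ℕ → X → ℂ}
    (hg : IsDyadicFamily s g) (n N : ℕ) :
    (fun x => iteratedFDeriv ℝ n (fun x => ∑' j, g j x) x) =O[cocompact X]
      fun x => japaneseBracket x ^ (-(N : ℝ)) := by
  -- `k > s + n` gives convergence, `k > N` the required decay.
  obtain ⟨k, hk⟩ := exists_nat_gt (max (s + n) N)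
  obtain ⟨C, hC, h⟩ := hg.exists_sum_norm_le_pow n (k := k) ((le_max_left _ _).trans_lt hk)
  have hNk : N ≤ k := by exact_mod_cast ((le_max_right _ _).trans_lt hk).le
  refine Asymptotics.IsBigO.of_bound (C * 2 ^ N) ?_
  filter_upwards [(tendsto_norm_cocompact_atTop (E := X)).eventually_ge_atTop 1] with x hx
  have hx0 : x ≠ 0 := norm_pos_iff.1 (by linarith)
  have hJ : 0 < japaneseBracket x := one_pos.trans_le (one_le_japaneseBracket x)
  rw [Real.norm_of_nonneg (by positivity), mul_assoc]
  refine (hg.norm_tsum_le_of_sum_norm_le n hx0 (h x hx0)).trans ?_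
  gcongr
  exact inv_norm_pow_le_japaneseBracket hx hNk

/-- For `‖x‖ ≤ 1` the bracket is bounded and `‖x‖^{-s}` suffices; for `‖x‖ ≥ 1` the bound `‖x‖^{-k}`
gives the decay. -/
theorem IsDyadicFamily.exists_norm_tsum_le {E : Type*} [NormedAddCommGroup E] [NormedSpace ℝ E]
    {s : ℝ} {g : ℕ → E → ℂ}
    (hg : IsDyadicFamily s g) (hs : 0 < s) (N : ℕ) :
    ∃ C : ℝ, 0 < C ∧ ∀ x : E, x ≠ 0 →
      ‖∑' j, g j x‖ ≤ C * japaneseBracket x ^ (-(N : ℝ)) * (1 + ‖x‖ ^ (-s)) := by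
  obtain ⟨k, hk⟩ := exists_nat_gt (max (s + (0 : ℕ)) N)
  obtain ⟨C₀, hC₀, h₀⟩ := hg.exists_sum_norm_le_pow 0 (k := k) ((le_max_left _ _).trans_lt hk)
  have hNk : N ≤ k := by exact_mod_cast ((le_max_right _ _).trans_lt hk).le
  obtain ⟨C₁, hC₁, h₁⟩ := hg.exists_sum_norm_le_rpow hs le_rfl
  refine ⟨(C₀ + C₁) * 2 ^ N, by positivity, fun x hx => ?_⟩
  have hr : 0 < ‖x‖ := norm_pos_iff.2 hx
  have hJ : 0 < japaneseBracket x := one_pos.trans_le (one_le_japaneseBracket x)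
  have hp : 0 < japaneseBracket x ^ (-(N : ℝ)) := by positivity
  have hq : 0 < ‖x‖ ^ (-s) := by positivity
  rcases le_total ‖x‖ 1 with hle | hge
  · have h2 : ‖∑' j, g j x‖ ≤ C₁ * ‖x‖ ^ (-s) := by
      simpa using hg.norm_tsum_le_of_sum_norm_le 0 hx (by simpa using h₁ x hx)
    calc _ ≤ C₁ * ‖x‖ ^ (-s) * 1 := by rwa [mul_one]
      _ ≤ (C₀ + C₁) * (1 + ‖x‖ ^ (-s)) * (2 ^ N * japaneseBracket x ^ (-(N : ℝ))) := by
          gcongr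
          · linarith
          · linarith
          · exact one_le_two_pow_mul_japaneseBracket hle N
      _ = _ := by ring
  · have h2 : ‖∑' j, g j x‖ ≤ C₀ * (‖x‖ ^ k)⁻¹ := by
      simpa using hg.norm_tsum_le_of_sum_norm_le 0 hx (h₀ x hx)
    calc _ ≤ C₀ * (‖x‖ ^ k)⁻¹ * 1 := by rwa [mul_one]
      _ ≤ (C₀ + C₁) * (2 ^ N * japaneseBracket x ^ (-(N : ℝ))) * (1 + ‖x‖ ^ (-s)) := by
          gcongr
          · linarith
          · exact inv_norm_pow_le_japaneseBracket hge hNk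
          · linarith
      _ = _ := by ring

variable [MeasurableSpace X] [BorelSpace X]

/-- A dyadic family of order `s < n` has an integrable majorant. -/
theorem IsDyadicFamily.exists_integrable_majorant {s : ℝ} {g : ℕ → X → ℂ}
    (hg : IsDyadicFamily s g) (hn : 0 < Module.finrank ℝ X) (hs : s < Module.finrank ℝ X) :
    ∃ H : X → ℝ, Integrable H ∧ ∀ x, x ≠ 0 → ∀ J : ℕ,
      ∑ j ∈ Finset.range J, ‖g j x‖ ≤ H x := by
  have hn' : (0 : ℝ) < Module.finrank ℝ X := by exact_mod_cast hn
  -- `t < n` makes `‖x‖^{-t}` integrable at `0`; the maximum with `n / 2` keeps `t` positive when `s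
  -- ≤ 0`.
  set t : ℝ := max s (Module.finrank ℝ X / 2)
  have ht0 : 0 < t := (by positivity : (0 : ℝ) < Module.finrank ℝ X / 2).trans_le (le_max_right _ _)
  have htn : t < Module.finrank ℝ X := max_lt hs (by linarith)
  obtain ⟨k, hk⟩ := exists_nat_gt (max (s + (0 : ℕ)) (Module.finrank ℝ X))
  obtain ⟨C₀, hC₀, h₀⟩ := hg.exists_sum_norm_le_pow 0 (k := k) ((le_max_left _ _).trans_lt hk)
  obtain ⟨C₁, hC₁, h₁⟩ := hg.exists_sum_norm_le_rpow ht0 (le_max_left _ _)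
  simp only [norm_iteratedFDeriv_zero] at h₀
  have hmeas : AEStronglyMeasurable (fun x : X => C₁ * ‖x‖ ^ (-t)) volume := by
    have : Measurable fun x : X => C₁ * ‖x‖ ^ (-t) := by fun_prop
    exact this.aestronglyMeasurable
  have hI₁ : IntegrableOn (fun x : X => C₁ * ‖x‖ ^ (-t)) (Metric.ball 0 1) := by
    refine integrableOn_ball_of_norm_le_rpow (C := C₁) hn htn
      (Eventually.of_forall fun x => ?_) hmeas
    rw [Real.norm_of_nonneg (by positivity)]
  have hI₀ : Integrable fun x : X => C₀ * 2 ^ k * (1 + ‖x‖) ^ (-(k : ℝ)) :=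
    (integrable_one_add_norm ((le_max_right _ _).trans_lt hk)).const_mul _
  refine ⟨_, (hI₁.integrable_indicator Metric.isOpen_ball.measurableSet).add hI₀,
    fun x hx J => ?_⟩
  simp only [Pi.add_apply]
  by_cases hb : x ∈ Metric.ball (0 : X) 1
  · rw [Set.indicator_of_mem hb]
    have : 0 ≤ C₀ * 2 ^ k * (1 + ‖x‖) ^ (-(k : ℝ)) := by positivity
    linarith [h₁ x hx J]
  · rw [Set.indicator_of_notMem hb, zero_add]
    have h1 : 1 ≤ ‖x‖ := by simpa using hb
    refine (h₀ x hx J).trans ?_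
    rw [mul_assoc, Real.rpow_neg (by positivity), Real.rpow_natCast, ← inv_pow, ← inv_pow,
      ← mul_pow]
    gcongr
    rw [← div_eq_mul_inv, inv_le_comm₀ (by positivity) (by positivity), inv_div,
      div_le_iff₀ two_pos]
    linarith

variable {m : ℝ} {a : StrongDual ℝ X → ℂ} {χ : X → ℂ}

theorem IsSymbol.isClassSOutsideZero_tsum (ha : IsSymbol m a) (hχ : IsUnitCutoff χ) :
    IsClassSOutsideZero ha.fourierInverse fun x => ∑' j, fourierPiece ha hχ j x := by
  have hg := isDyadicFamily_fourierPiece ha hχ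
  refine ⟨fun φ _ hφ => ?_, hg.contDiffOn_tsum, hg.isBigO_iteratedFDeriv_tsum⟩
  -- The support of `φ` is closed and misses `0`, hence stays at distance `δ` from it; there the
  -- partial sums are bounded by `C δ^{-k}`.
  obtain ⟨δ, hδ, hball⟩ : ∃ δ > 0, Metric.ball (0 : X) δ ⊆ (tsupport φ)ᶜ :=
    Metric.isOpen_iff.1 (isClosed_tsupport φ).isOpen_compl 0 fun h => hφ h rfl
  have hsupp : ∀ x, φ x ≠ 0 → δ ≤ ‖x‖ := by
    intro x hx
    by_contra! h
    exact hball (by simpa using h) (subset_tsupport _ hx)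
  obtain ⟨k, hk⟩ := exists_nat_gt (m + Module.finrank ℝ X + (0 : ℕ))
  obtain ⟨C, hC, h⟩ := hg.exists_sum_norm_le_pow 0 hk
  simp only [norm_iteratedFDeriv_zero] at h
  refine ha.fourierInverse_eq_of_dominated hχ φ
    (φ.integrable.norm.mul_const (C * (δ ^ k)⁻¹)) (fun J => Eventually.of_forall fun x => ?_)
    (Eventually.of_forall fun x hx => hg.hasSum fun h0 => ?_)
  · by_cases h0 : φ x = 0
    · simp [h0]
    · have hx := hsupp x h0
      have hx0 : x ≠ 0 := norm_pos_iff.1 (by linarith)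
      gcongr
      exact (h x hx0 J).trans (by gcongr)
  · have := hsupp x hx
    rw [h0, norm_zero] at this
    linarith

theorem IsSymbol.integrable_tsum_of_majorant (ha : IsSymbol m a) (hχ : IsUnitCutoff χ)
    {H : X → ℝ} (hH : Integrable H)
    (hbound : ∀ᵐ x : X, ∀ J : ℕ, ∑ j ∈ Finset.range J, ‖fourierPiece ha hχ j x‖ ≤ H x)
    (hsum : ∀ᵐ x : X, Summable fun j => fourierPiece ha hχ j x) :
    Integrable (fun x => ∑' j, fourierPiece ha hχ j x) ∧
      ∀ φ : 𝓢(X, ℂ), ha.fourierInverse φ = ∫ x, φ x * ∑' j, fourierPiece ha hχ j x := by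
  constructor
  · refine hH.mono' (aestronglyMeasurable_of_tendsto_ae atTop
      (f := fun J x => ∑ j ∈ Finset.range J, fourierPiece ha hχ j x) (fun J =>
        (continuous_finsetSum _ fun j _ => continuous_fourierPiece ha hχ j).aestronglyMeasurable)
      (hsum.mono fun x hx => hx.hasSum.tendsto_sum_nat)) ?_
    filter_upwards [hbound, hsum] with x hx hs
    exact le_of_tendsto hs.hasSum.tendsto_sum_nat.norm
      (Eventually.of_forall fun J => (norm_sum_le _ _).trans (hx J))
  · intro φ
    refine ha.fourierInverse_eq_of_dominated hχ φ
      (hH.const_mul (SchwartzMap.seminorm ℂ 0 0 φ)) (fun J => ?_)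
      (hsum.mono fun x hx _ => hx.hasSum)
    filter_upwards [hbound] with x hx
    exact mul_le_mul (SchwartzMap.norm_le_seminorm ℂ φ x) (hx J)
      (Finset.sum_nonneg fun _ _ => norm_nonneg _) (apply_nonneg _ _)

theorem IsSymbol.integrable_tsum_of_neg (ha : IsSymbol m a) (hχ : IsUnitCutoff χ) (hm : m < 0) :
    Integrable (fun x => ∑' j, fourierPiece ha hχ j x) ∧
      ∀ φ : 𝓢(X, ℂ), ha.fourierInverse φ = ∫ x, φ x * ∑' j, fourierPiece ha hχ j x := by
  have hg := isDyadicFamily_fourierPiece ha hχ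
  rcases Nat.eq_zero_or_pos (Module.finrank ℝ X) with hn | hn
  -- In dimension zero the origin is not a null set, but the order is `m < 0`, so the series
  -- converges even there.
  · have : Subsingleton X := Module.finrank_zero_iff.1 hn
    obtain ⟨C, hC, h⟩ := norm_fourierPiece_le ha hχ
    have hs : Summable fun j : ℕ => C * ((2 : ℝ) ^ j) ^ (m + Module.finrank ℝ X) :=
      (summable_two_pow_rpow (by simpa [hn] using hm)).mul_left C
    refine ha.integrable_tsum_of_majorant hχ (integrable_const (∑' j : ℕ, C * ((2 : ℝ) ^ j) ^
      (m + Module.finrank ℝ X))) (Eventually.of_forall fun x J => ?_)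
      (Eventually.of_forall fun x => Summable.of_norm_bounded hs fun j => h j x)
    exact (Finset.sum_le_sum fun j _ => h j x).trans
      (hs.sum_le_tsum _ fun _ _ => by positivity)
  · have : Nontrivial X := Module.nontrivial_of_finrank_pos hn
    obtain ⟨H, hH, hb⟩ := hg.exists_integrable_majorant hn (by linarith)
    have hae : ∀ᵐ x : X, x ≠ 0 := by simp [ae_iff]
    exact ha.integrable_tsum_of_majorant hχ hH (hae.mono fun x hx J => hb x hx J)
      (hae.mono fun x hx => (hg.hasSum hx).summable)

end Main

end SymbolFourier

theorem mainTheorem9 {X : Type*} [NormedAddCommGroup X] [InnerProductSpace ℝ X]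
    [FiniteDimensional ℝ X] [MeasurableSpace X] [BorelSpace X]
    (m : ℝ) (a : StrongDual ℝ X → ℂ) (ha : SymbolFourier.IsSymbol m a) :
    ∃ f : X → ℂ,
      SymbolFourier.IsClassSOutsideZero ha.fourierInverse f ∧
      (0 < m + (Module.finrank ℝ X : ℝ) → ∀ N : ℕ, ∃ C : ℝ, 0 < C ∧ ∀ x : X, x ≠ 0 →
        ‖f x‖ ≤ C * SymbolFourier.japaneseBracket x ^ (-(N : ℝ)) *
          (1 + ‖x‖ ^ (-m - (Module.finrank ℝ X : ℝ)))) ∧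
      (m < 0 → Integrable f volume ∧ ∀ φ : 𝓢(X, ℂ), ha.fourierInverse φ = ∫ x, φ x * f x) := by
  obtain ⟨χ, hχ⟩ := SymbolFourier.exists_isUnitCutoff (E := X)
  -- The witness is the sum of the dyadic series, the same function for all three claims.
  refine ⟨_, ha.isClassSOutsideZero_tsum hχ, fun hs N => ?_, ha.integrable_tsum_of_neg hχ⟩
  have := (SymbolFourier.isDyadicFamily_fourierPiece ha hχ).exists_norm_tsum_le hs N
  rwa [neg_add'] at this
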